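/- The energy $\mathcal{E}(G)$ of a finite simple graph $G$ is the sum of the absolute values of the eigenvalues of its adjacency matrix, counted with multiplicity. Let $K_{1,i,n-i-1}$ denote the complete tripartite graph on $n$ vertices whose parts have sizes $1$, $i$ and $n-i-1$, where $i\ge 1$ and $n-i-1\ge 1$ (all parts are non-empty), and for an edge $e$ of it let $K_{1,i,n-i-1}-e$ be the graph obtained by deleting $e$ and keeping all vertices. 1. For every $n\ge 4$ and every edge $e$ between the first part (of size $1$) and the second part (of size $2$) of $K_{1,2,n-3}$, $$\mathcal{E}(K_{1,2,n-3}-e)<\mathcal{E}(K_{1,2,n-3}).$$ 2. For every $i\ge 3$, every $n\ge i+2$ and every edge $e$ between the first part (of size $1$) and the second part (of size $i$) of $K_{1,i,n-i-1}$, $$\mathcal{E}(K_{1,i,n-i-1}-e)>\mathcal{E}(K_{1,i,n-i-1}).$$ -/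

import Mathlib

open Classical in
/-- The energy of a finite simple graph: the sum of the absolute values of the eigenvalues
(counted with multiplicity) of its adjacency matrix. -/
noncomputable def graphEnergy {V : Type*} [Fintype V] (G : SimpleGraph V) : ℝ :=
  ∑ v : V, |(G.isHermitian_adjMatrix ℝ).eigenvalues v|

/-- The vertices of `K_{a,b,c}`: pairs `⟨j, x⟩` where `j : Fin 3` is the part containing the
vertex; the parts `0`, `1`, `2` have `a`, `b`, `c` vertices. -/
abbrev TripartiteVertex (a b c : ℕ) : Type := Σ j : Fin 3, Fin (![a, b, c] j)

/-- The complete tripartite graph `K_{a,b,c}`: two vertices are adjacent iff they lie in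
different parts. -/
abbrev completeTripartite (a b c : ℕ) : SimpleGraph (TripartiteVertex a b c) :=
  SimpleGraph.completeMultipartiteGraph (fun j : Fin 3 => Fin (![a, b, c] j))

/-!
Both graphs have a vertex partition into very few classes such that adjacency depends only on the
classes of the two vertices. Writing the adjacency matrix as `S * (Q * Sᵀ)`, with `S` the indicator
matrix of the classes, the identity between the characteristic polynomials of `X * Y` and `Y * X`
shows that its nonzero eigenvalues are those of the small matrix `Q * diagonal (class sizes)`
(`exists_multiset_graphEnergy_eq`).

For `K_{1,i,m}` the small characteristic polynomial is `t³ - (i + m + i m) t - 2 i m`. It has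
exactly one positive root `μ`, so the energy is `2 μ`. For `K_{1,i,m} - e`, put `T = (i - 1) m` and
`E = i - 1 + m + i m`, the numbers of triangles and edges. The polynomial is `t⁴ - E t² - 2 T t + T`;
it has two positive and two negative roots, and half of the energy is the sum `σ` of the two positive
ones. Factoring the quartic as `(t² - σ t + P) (t² + σ t + Q)` and eliminating `P`, `Q` gives the
resolvent equation `R (σ²) = 4 T²`, where `R s = s ((s - E)² - 4 T)`.

Since `R` is increasing where `s > E` and `R s > 0`, comparing `μ` with `σ` amounts to comparing
`R (μ²)` with `4 T²` (`lt_of_resolvent_lt`, `lt_of_lt_resolvent`). Here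
`R (μ²) = (μ + 2 i m)² - 4 T μ²` by the cubic equation of `μ`, and elementary estimates on `μ` decide
the sign: `resolvent_gt_of_cubic_root_two` for `i = 2`, `resolvent_lt_of_cubic_root` for `i ≥ 3`.
-/

/-! ### Energy from a quotient matrix -/

open Polynomial in
/-- If adjacency in `G` is given by a matrix `Q` on the classes of a partition `c` whose class `k`
has `s k` elements, then the energy of `G` is the sum of the absolute values of the eigenvalues of
`Q * diagonal s`. The eigenvalues are real, hence the multiset `R` has full size. -/
theorem exists_multiset_graphEnergy_eq {V κ : Type*} [Fintype V] [Fintype κ] [DecidableEq κ]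
    (G : SimpleGraph V) (c : V → κ) (Q : Matrix κ κ ℝ) (s : κ → ℝ)
    (hadj : ∀ v w, G.Adj v w → Q (c v) (c w) = 1)
    (hnadj : ∀ v w, ¬ G.Adj v w → Q (c v) (c w) = 0)
    (hs : ∀ k, ∑ v, (if c v = k then (1 : ℝ) else 0) = s k) :
    ∃ R : Multiset ℝ, R.card = Fintype.card κ ∧ graphEnergy G = (R.map (|·|)).sum ∧
      ∀ t : ℝ, (Matrix.scalar κ t - Q * Matrix.diagonal s).det = (R.map (t - ·)).prod := by
  classical
  set A : Matrix V V ℝ := G.adjMatrix ℝ with hA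
  have hH : A.IsHermitian := G.isHermitian_adjMatrix ℝ
  have hE : graphEnergy G = (A.charpoly.roots.map (|·|)).sum := by
    rw [hH.roots_charpoly_eq_eigenvalues, Multiset.map_map]
    unfold graphEnergy
    simp only [Finset.sum]
    congr!
  let S : Matrix V κ ℝ := Matrix.of fun v k => if c v = k then 1 else 0
  have hAS : A = S * (Q * S.transpose) := by
    ext v w
    simp only [Matrix.mul_apply, S, Matrix.of_apply, Matrix.transpose_apply, ite_mul, one_mul,
      zero_mul, mul_ite, mul_one, mul_zero, Finset.sum_ite_eq, Finset.mem_univ, if_true,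
      hA, SimpleGraph.adjMatrix_apply]
    split_ifs with h
    · exact (hadj v w h).symm
    · exact (hnadj v w h).symm
  have hSS : Q * S.transpose * S = Q * Matrix.diagonal s := by
    rw [Matrix.mul_assoc]
    congr 1
    ext k l
    simp only [Matrix.mul_apply, S, Matrix.of_apply, Matrix.transpose_apply, Matrix.diagonal_apply]
    rw [← hs k]
    split_ifs with h
    · subst h
      exact Finset.sum_congr rfl fun v _ => by split_ifs <;> simp
    · refine Finset.sum_eq_zero fun v _ => ?_
      split_ifs with h1 h2 <;> simp
      exact h (h1.symm.trans h2)
  -- `X ^ card κ * A.charpoly = X ^ card V * (quotient).charpoly`; extra zero roots cost no energy.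
  have hc := Matrix.charpoly_mul_comm' S (Q * S.transpose)
  rw [← hAS, hSS] at hc
  set B := Q * Matrix.diagonal s
  have hAm := A.charpoly_monic
  have hBm := B.charpoly_monic
  have hr := congrArg roots hc
  rw [roots_mul ((monic_X_pow _).mul hAm).ne_zero, roots_mul ((monic_X_pow _).mul hBm).ne_zero,
    roots_X_pow, roots_X_pow] at hr
  have hcardA : A.charpoly.roots.card = Fintype.card V := by
    simp [hH.roots_charpoly_eq_eigenvalues]
  have hcardB : B.charpoly.roots.card = Fintype.card κ := by
    have := congrArg Multiset.card hr
    simp only [Multiset.card_add, Multiset.card_nsmul, Multiset.card_singleton, hcardA] at this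
    omega
  refine ⟨B.charpoly.roots, hcardB, ?_, fun t => ?_⟩
  · have := congrArg (fun m : Multiset ℝ => (m.map (|·|)).sum) hr
    simpa [Multiset.map_nsmul, Multiset.sum_nsmul, hE] using this
  · rw [← Matrix.eval_charpoly]
    conv_lhs => rw [← prod_multiset_X_sub_C_of_monic_of_roots_card_eq hBm
      (hcardB.trans B.charpoly_natDegree_eq_dim.symm)]
    rw [eval_multiset_prod, Multiset.map_map]
    simp

/-! ### Roots of the cubic and of the quartic -/

/-- Three real numbers with sum `0` and positive product: exactly one is positive, and it is half of
the sum of the absolute values. -/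
theorem abs_sum_of_cubic {a b x y z : ℝ} (hb : 0 < b)
    (h : ∀ t : ℝ, (t - x) * (t - y) * (t - z) = t ^ 3 - a * t - b) :
    ∃ μ : ℝ, 0 < μ ∧ μ ^ 3 = a * μ + b ∧ |x| + |y| + |z| = 2 * μ := by
  have hz : z = -x - y := by linarith [h 0, h 1, h (-1)]
  have h3 : x * y * z = b := by linarith [h 0]
  have hx := h x
  have hy := h y
  have hz' := h z
  rcases lt_trichotomy x 0 with h1 | h1 | h1
  · rcases lt_trichotomy y 0 with h2 | h2 | h2
    · refine ⟨z, by linarith, by linarith, ?_⟩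
      rw [abs_of_neg h1, abs_of_neg h2, abs_of_pos (by linarith)]; linarith
    · subst h2; simp at h3; linarith
    · have h4 : z < 0 := by
        by_contra hn
        nlinarith [mul_nonneg (mul_nonneg (neg_pos.2 h1).le h2.le) (not_lt.1 hn)]
      refine ⟨y, h2, by linarith, ?_⟩
      rw [abs_of_neg h1, abs_of_pos h2, abs_of_neg h4]; linarith
  · subst h1; simp at h3; linarith
  · rcases lt_trichotomy y 0 with h2 | h2 | h2
    · have h4 : z < 0 := by
        by_contra hn
        nlinarith [mul_nonneg (mul_nonneg (neg_pos.2 h2).le h1.le) (not_lt.1 hn)]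
      refine ⟨x, h1, by linarith, ?_⟩
      rw [abs_of_pos h1, abs_of_neg h2, abs_of_neg h4]; linarith
    · subst h2; simp at h3; linarith
    · nlinarith [mul_pos h1 h2]

/-- The quartic with the signs of its roots prescribed: the sum `σ` of the positive roots satisfies
the resolvent equation. The hypotheses are symmetric in the roots, so that the pairs may be
permuted. -/
theorem abs_sum_of_two_pos_two_neg {E T x y z w : ℝ} (hx : 0 < x) (hy : 0 < y) (hz : z < 0)
    (hw : w < 0) (h1 : x + y + z + w = 0)
    (h2 : x * y + x * z + x * w + y * z + y * w + z * w = -E)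
    (h3 : x * y * z + x * y * w + x * z * w + y * z * w = 2 * T)
    (h4 : x * y * z * w = T) :
    ∃ σ : ℝ, 0 < σ ∧ E < σ ^ 2 ∧ σ ^ 2 * ((σ ^ 2 - E) ^ 2 - 4 * T) = 4 * T ^ 2 ∧
      |x| + |y| + |z| + |w| = 2 * σ := by
  have hzw : 0 < z * w := mul_pos_of_neg_of_neg hz hw
  have e : w = -x - y - z := by linarith
  have hE : (x + y) ^ 2 - E = x * y + z * w := by
    rw [← neg_eq_iff_eq_neg.2 h2]; subst e; ring
  have hd : (x + y) * (z * w - x * y) = 2 * T := by rw [← h3]; subst e; ring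
  refine ⟨x + y, by linarith, by linarith [mul_pos hx hy], ?_, ?_⟩
  · rw [hE, show (4 : ℝ) * T ^ 2 = (2 * T) ^ 2 by ring, ← hd, ← h4]; ring
  · rw [abs_of_pos hx, abs_of_pos hy, abs_of_neg hz, abs_of_neg hw]; linarith

/-- Four real roots with sum `0` and positive product form two positive and two negative ones. -/
theorem abs_sum_of_quartic {E T x y z w : ℝ} (hT : 0 < T)
    (h : ∀ t : ℝ, (t - x) * (t - y) * (t - z) * (t - w) = t ^ 4 - E * t ^ 2 - 2 * T * t + T) :
    ∃ σ : ℝ, 0 < σ ∧ E < σ ^ 2 ∧ σ ^ 2 * ((σ ^ 2 - E) ^ 2 - 4 * T) = 4 * T ^ 2 ∧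
      |x| + |y| + |z| + |w| = 2 * σ := by
  have h4 : x * y * z * w = T := by linarith [h 0]
  have h1 : x + y + z + w = 0 := by linarith [h 0, h 1, h (-1), h 2]
  have h2 : x * y + x * z + x * w + y * z + y * w + z * w = -E := by linarith [h 0, h 1, h (-1)]
  have h3 : x * y * z + x * y * w + x * z * w + y * z * w = 2 * T := by
    linarith [h 0, h 1, h (-1), h 2]
  have hne : x * y * z * w ≠ 0 := by rw [h4]; exact hT.ne'
  have hw0 : w ≠ 0 := right_ne_zero_of_mul hne
  have hz0 : z ≠ 0 := right_ne_zero_of_mul (left_ne_zero_of_mul hne)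
  have hy0 : y ≠ 0 := right_ne_zero_of_mul (left_ne_zero_of_mul (left_ne_zero_of_mul hne))
  have hx0 : x ≠ 0 := left_ne_zero_of_mul (left_ne_zero_of_mul (left_ne_zero_of_mul hne))
  have hpos : 0 < (x * y) * (z * w) := by linarith
  rcases hx0.lt_or_gt with hx | hx <;> rcases hy0.lt_or_gt with hy | hy <;>
  rcases hz0.lt_or_gt with hz | hz <;> rcases hw0.lt_or_gt with hw | hw
  · linarith
  · nlinarith [mul_pos_of_neg_of_neg hx hy, mul_neg_of_neg_of_pos hz hw]
  · nlinarith [mul_pos_of_neg_of_neg hx hy, mul_neg_of_pos_of_neg hz hw]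
  · obtain ⟨σ, s1, s2, s3, s4⟩ := abs_sum_of_two_pos_two_neg (E := E) (T := T) hz hw hx hy
      (by linarith) (by linarith) (by linarith) (by linarith)
    exact ⟨σ, s1, s2, s3, by linarith⟩
  · nlinarith [mul_neg_of_neg_of_pos hx hy, mul_pos_of_neg_of_neg hz hw]
  · obtain ⟨σ, s1, s2, s3, s4⟩ := abs_sum_of_two_pos_two_neg (E := E) (T := T) hy hw hx hz
      (by linarith) (by linarith) (by linarith) (by linarith)
    exact ⟨σ, s1, s2, s3, by linarith⟩
  · obtain ⟨σ, s1, s2, s3, s4⟩ := abs_sum_of_two_pos_two_neg (E := E) (T := T) hy hz hx hw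
      (by linarith) (by linarith) (by linarith) (by linarith)
    exact ⟨σ, s1, s2, s3, by linarith⟩
  · nlinarith [mul_neg_of_neg_of_pos hx hy, mul_pos hz hw]
  · nlinarith [mul_neg_of_pos_of_neg hx hy, mul_pos_of_neg_of_neg hz hw]
  · obtain ⟨σ, s1, s2, s3, s4⟩ := abs_sum_of_two_pos_two_neg (E := E) (T := T) hx hw hy hz
      (by linarith) (by linarith) (by linarith) (by linarith)
    exact ⟨σ, s1, s2, s3, by linarith⟩
  · obtain ⟨σ, s1, s2, s3, s4⟩ := abs_sum_of_two_pos_two_neg (E := E) (T := T) hx hz hy hw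
      (by linarith) (by linarith) (by linarith) (by linarith)
    exact ⟨σ, s1, s2, s3, by linarith⟩
  · nlinarith [mul_neg_of_pos_of_neg hx hy, mul_pos hz hw]
  · exact abs_sum_of_two_pos_two_neg hx hy hz hw h1 h2 h3 h4
  · nlinarith [mul_pos hx hy, mul_neg_of_neg_of_pos hz hw]
  · nlinarith [mul_pos hx hy, mul_neg_of_pos_of_neg hz hw]
  · linarith

/-! ### Comparison through the resolvent -/

theorem lt_of_resolvent_lt {μ σ E T : ℝ} (hμ : 0 < μ) (hσ : 0 < σ) (hμE : E < μ ^ 2)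
    (hσ4 : σ ^ 2 * ((σ ^ 2 - E) ^ 2 - 4 * T) = 4 * T ^ 2)
    (h : 4 * T ^ 2 < μ ^ 2 * ((μ ^ 2 - E) ^ 2 - 4 * T)) : σ < μ := by
  by_contra! hle
  have hsq : μ ^ 2 ≤ σ ^ 2 := pow_le_pow_left₀ hμ.le hle 2
  have h0 : 0 ≤ (σ ^ 2 - E) ^ 2 - 4 * T := by
    by_contra! hn
    nlinarith [mul_pos (pow_pos hσ 2) (neg_pos.2 hn), sq_nonneg T]
  have h1 : (μ ^ 2 - E) ^ 2 ≤ (σ ^ 2 - E) ^ 2 :=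
    pow_le_pow_left₀ (by linarith) (by linarith) 2
  have h2 : μ ^ 2 * ((μ ^ 2 - E) ^ 2 - 4 * T) ≤ μ ^ 2 * ((σ ^ 2 - E) ^ 2 - 4 * T) :=
    mul_le_mul_of_nonneg_left (by linarith) (sq_nonneg μ)
  have h3 := mul_le_mul_of_nonneg_right hsq h0
  linarith

theorem lt_of_lt_resolvent {μ σ E T : ℝ} (hσ : 0 < σ) (hσE : E < σ ^ 2)
    (hσ4 : σ ^ 2 * ((σ ^ 2 - E) ^ 2 - 4 * T) = 4 * T ^ 2)
    (h : μ ^ 2 * ((μ ^ 2 - E) ^ 2 - 4 * T) < 4 * T ^ 2) : μ < σ := by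
  by_contra! hle
  have hsq : σ ^ 2 ≤ μ ^ 2 := pow_le_pow_left₀ hσ.le hle 2
  have h0 : 0 ≤ (σ ^ 2 - E) ^ 2 - 4 * T := by
    by_contra! hn
    nlinarith [mul_pos (pow_pos hσ 2) (neg_pos.2 hn), sq_nonneg T]
  have h1 : (σ ^ 2 - E) ^ 2 ≤ (μ ^ 2 - E) ^ 2 :=
    pow_le_pow_left₀ (by linarith) (by linarith) 2
  have h2 := mul_le_mul_of_nonneg_right hsq h0
  have h3 : μ ^ 2 * ((σ ^ 2 - E) ^ 2 - 4 * T) ≤ μ ^ 2 * ((μ ^ 2 - E) ^ 2 - 4 * T) :=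
    mul_le_mul_of_nonneg_left (by linarith) (sq_nonneg μ)
  linarith

/-! ### The two energies -/

/-- The part `j` of `K_{a,b,m}` has `![a, b, m] j` vertices. -/
theorem sum_indicator_part (a b m : ℕ) (j : Fin 3) :
    ∑ w : TripartiteVertex a b m, (if w.1 = j then (1 : ℝ) else 0) = ![(a : ℝ), b, m] j := by
  rw [Fintype.sum_sigma]
  have h : ∀ k : Fin 3, ∑ _x : Fin (![a, b, m] k), (if k = j then (1 : ℝ) else 0) =
      if k = j then ((![a, b, m] k : ℕ) : ℝ) else 0 := fun k => by split_ifs <;> simp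
  rw [Finset.sum_congr rfl fun k _ => h k, Finset.sum_ite_eq' Finset.univ j,
    if_pos (Finset.mem_univ j)]
  fin_cases j <;> rfl

theorem graphEnergy_completeTripartite {i m : ℕ} (hi : 0 < i) (hm : 0 < m) :
    ∃ μ : ℝ, 0 < μ ∧ μ ^ 3 = ((i : ℝ) + m + i * m) * μ + 2 * i * m ∧
      graphEnergy (completeTripartite 1 i m) = 2 * μ := by
  obtain ⟨R, hR, hE, hdet⟩ := exists_multiset_graphEnergy_eq (completeTripartite 1 i m)
    (fun w => w.1) !![0, 1, 1; 1, 0, 1; 1, 1, 0] ![1, (i : ℝ), m]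
    (by
      rintro ⟨j, x⟩ ⟨k, y⟩ h
      rw [SimpleGraph.comap_adj, SimpleGraph.top_adj] at h
      fin_cases j <;> fin_cases k <;> simp_all)
    (by
      rintro ⟨j, x⟩ ⟨k, y⟩ h
      rw [SimpleGraph.comap_adj, SimpleGraph.top_adj] at h
      fin_cases j <;> fin_cases k <;> simp_all)
    (fun k => by simpa using sum_indicator_part 1 i m k)
  rw [Fintype.card_fin, Multiset.card_eq_three] at hR
  obtain ⟨x, y, z, rfl⟩ := hR
  have hb : (0 : ℝ) < 2 * i * m := by positivity
  obtain ⟨μ, h1, h2, h3⟩ := abs_sum_of_cubic (a := (i : ℝ) + m + i * m) (x := x) (y := y)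
    (z := z) hb (fun t => by
      have := hdet t
      simp [Matrix.det_fin_three, Matrix.mul_diagonal, Matrix.scalar_apply,
        -Matrix.cons_mul] at this
      linarith)
  refine ⟨μ, h1, h2, ?_⟩
  rw [hE, ← h3]
  simp [add_assoc]

/-- The classes for `K_{1,i,m} - uv` are `{u}`, the second part without `v`, the third part, and
`{v}`; their numbers are `0`, `1`, `2`, `3`. -/
theorem graphEnergy_completeTripartite_deleteEdges {i m : ℕ} (hi : 2 ≤ i) (hm : 0 < m)
    (u v : TripartiteVertex 1 i m) (hu : u.1 = 0) (hv : v.1 = 1) :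
    ∃ σ : ℝ, 0 < σ ∧ (i : ℝ) - 1 + m + i * m < σ ^ 2 ∧
      σ ^ 2 * ((σ ^ 2 - ((i : ℝ) - 1 + m + i * m)) ^ 2 - 4 * ((i - 1) * m))
        = 4 * ((i - 1) * m) ^ 2 ∧
      graphEnergy ((completeTripartite 1 i m).deleteEdges {s(u, v)}) = 2 * σ := by
  have huniq : ∀ w : TripartiteVertex 1 i m, w = u ↔ w.1 = 0 := by
    refine fun w => ⟨fun h => h ▸ hu, fun hw => ?_⟩
    obtain ⟨j, x⟩ := w
    obtain ⟨k, y⟩ := u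
    dsimp only at hw hu
    subst hw hu
    congr 1
    exact Subsingleton.elim (α := Fin 1) x y
  let c : TripartiteVertex 1 i m → Fin 4 := fun w => if w = v then 3 else w.1.castSucc
  have hcv : c v = 3 := if_pos rfl
  have hc : ∀ w, w ≠ v → c w = w.1.castSucc := fun w hw => if_neg hw
  let Q : Matrix (Fin 4) (Fin 4) ℝ := !![0, 1, 1, 0; 1, 0, 1, 0; 1, 1, 0, 1; 0, 0, 1, 0]
  have hadj : ∀ w w', ((completeTripartite 1 i m).deleteEdges {s(u, v)}).Adj w w' ↔
      w.1 ≠ w'.1 ∧ ¬ (w.1 = 0 ∧ w' = v ∨ w = v ∧ w'.1 = 0) := by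
    intro w w'
    rw [SimpleGraph.deleteEdges_adj, SimpleGraph.comap_adj, SimpleGraph.top_adj,
      Set.mem_singleton_iff, Sym2.eq_iff, huniq w, huniq w']
  have hQ : ∀ w w', Q (c w) (c w') = if w.1 ≠ w'.1 ∧ ¬ (w.1 = 0 ∧ w' = v ∨ w = v ∧ w'.1 = 0)
      then 1 else 0 := by
    intro w w'
    by_cases hw : w = v <;> by_cases hw' : w' = v
    · subst hw hw'; simp [hcv, Q]
    · rw [hc w' hw', hw, hcv, hv]
      generalize w'.1 = k
      fin_cases k <;> simp [Q, hw']
    · rw [hc w hw, hw', hcv, hv]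
      generalize w.1 = k
      fin_cases k <;> simp [Q, hw]
    · rw [hc w hw, hc w' hw']
      generalize w.1 = k
      generalize w'.1 = l
      fin_cases k <;> fin_cases l <;> simp [Q, hw, hw']
  have hs : ∀ k, ∑ w, (if c w = k then (1 : ℝ) else 0) = ![1, (i : ℝ) - 1, m, 1] k := by
    have hlast : ∑ w, (if c w = 3 then (1 : ℝ) else 0) = 1 := by
      rw [Fintype.sum_eq_single v, if_pos hcv]
      intro w hw
      rw [hc w hw]
      exact if_neg (Fin.castSucc_lt_last w.1).ne
    have hcast : ∀ j : Fin 3, ∑ w, (if c w = j.castSucc then (1 : ℝ) else 0) =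
        ![(1 : ℝ), i, m] j - if j = 1 then 1 else 0 := by
      intro j
      have h1 := sum_indicator_part 1 i m j
      have h2 : ∑ w : TripartiteVertex 1 i m, (if w = v then (if j = 1 then (1 : ℝ) else 0) else 0)
          = if j = 1 then 1 else 0 := by simp
      rw [Nat.cast_one] at h1
      rw [← h1, ← h2, ← Finset.sum_sub_distrib]
      refine Finset.sum_congr rfl fun w _ => ?_
      by_cases hw : w = v
      · rw [hw, hcv, hv, if_pos rfl,
          if_neg (show 3 ≠ j.castSucc from (Fin.castSucc_lt_last j).ne')]
        simp [eq_comm]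
      · rw [hc w hw, if_neg hw, sub_zero]
        simp only [Fin.castSucc_inj]
    intro k
    fin_cases k
    · simpa using hcast 0
    · simpa using hcast 1
    · simpa using hcast 2
    · simpa using hlast
  obtain ⟨R, hR, hE, hdet⟩ := exists_multiset_graphEnergy_eq
    ((completeTripartite 1 i m).deleteEdges {s(u, v)}) c Q ![1, (i : ℝ) - 1, m, 1]
    (fun w w' h => by rw [hQ, if_pos ((hadj w w').1 h)])
    (fun w w' h => by rw [hQ, if_neg (mt (hadj w w').2 h)]) hs
  rw [Fintype.card_fin, Multiset.card_eq_four] at hR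
  obtain ⟨x, y, z, w, rfl⟩ := hR
  have hi' : (2 : ℝ) ≤ i := by exact_mod_cast hi
  have hm' : (0 : ℝ) < m := by exact_mod_cast hm
  have hT : 0 < ((i : ℝ) - 1) * m := mul_pos (by linarith) hm'
  obtain ⟨σ, h1, h2, h3, h4⟩ := abs_sum_of_quartic (E := (i : ℝ) - 1 + m + i * m) (x := x)
    (y := y) (z := z) (w := w) hT (fun t => by
      have := hdet t
      simp [Matrix.det_succ_row_zero, Fin.sum_univ_succ, Fin.succAbove, Matrix.mul_diagonal,
        Matrix.scalar_apply, Q, -Matrix.cons_mul] at this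
      linarith)
  refine ⟨σ, h1, h2, h3, ?_⟩
  rw [hE, ← h4]
  simp [add_assoc]

/-! ### Estimates on the root of the cubic -/

/-- The case `i = 2`, with `E = 1 + 3 m` and `T = m`. -/
theorem resolvent_gt_of_cubic_root_two {m μ : ℝ} (hm : 1 ≤ m) (hμ : 0 < μ)
    (h : μ ^ 3 = (2 + m + 2 * m) * μ + 2 * 2 * m) :
    4 * ((2 - 1) * m) ^ 2 < μ ^ 2 * ((μ ^ 2 - (2 - 1 + m + 2 * m)) ^ 2 - 4 * ((2 - 1) * m)) := by
  have h1 : μ * (μ ^ 2 - (2 - 1 + m + 2 * m)) = μ + 4 * m := by linear_combination h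
  have h2 : 3 * m + 2 < μ ^ 2 := by
    by_contra! hn
    nlinarith [mul_le_mul_of_nonneg_right hn hμ.le]
  have h3 : 2 < μ := by nlinarith
  have h4 : 0 < (1 - 4 * m) * μ ^ 2 + 8 * m * μ + 12 * m ^ 2 := by
    -- After multiplication by `μ` the cubic equation cancels the leading terms in `m`.
    refine pos_of_mul_pos_left (b := μ) ?_ hμ.le
    have e : ((1 - 4 * m) * μ ^ 2 + 8 * m * μ + 12 * m ^ 2) * μ =
        (2 - 5 * m) * μ + 4 * m - 16 * m ^ 2 + 8 * m * μ ^ 2 := by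
      linear_combination (1 - 4 * m) * h
    rw [e]
    have hm0 : 0 < m := by linarith
    nlinarith [mul_lt_mul_of_pos_left h2 hm0, mul_lt_mul_of_pos_left h3 (mul_pos hm0 hμ)]
  have e : μ ^ 2 * ((μ ^ 2 - (2 - 1 + m + 2 * m)) ^ 2 - 4 * ((2 - 1) * m)) =
      (μ + 4 * m) ^ 2 - 4 * m * μ ^ 2 := by rw [← h1]; ring
  rw [e]
  linarith

/-- The case `i ≥ 3`, for integral `m ≥ 1`. For `m = 1` the cubic factors, and the bounds that
settle `m ≥ 2` are too weak for `i = 3`. -/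
theorem resolvent_lt_of_cubic_root {i m μ : ℝ} (hi : 3 ≤ i) (hm : m = 1 ∨ 2 ≤ m) (hμ : 0 < μ)
    (h : μ ^ 3 = (i + m + i * m) * μ + 2 * i * m) :
    μ ^ 2 * ((μ ^ 2 - (i - 1 + m + i * m)) ^ 2 - 4 * ((i - 1) * m)) < 4 * ((i - 1) * m) ^ 2 := by
  have h1 : μ * (μ ^ 2 - (i - 1 + m + i * m)) = μ + 2 * i * m := by linear_combination h
  have hm0 : 0 < m := by rcases hm with hm | hm <;> linarith
  have him : 0 < i * m := mul_pos (by linarith) hm0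
  have h2 : i + m + i * m < μ ^ 2 := by
    by_contra! hn
    nlinarith [mul_le_mul_of_nonneg_right hn hμ.le]
  have h4 : 0 < (4 * ((i - 1) * m) - 1) * μ ^ 2 - 4 * i * m * μ - (8 * i - 4) * m ^ 2 := by
    rcases hm with rfl | hm
    · have e : μ ^ 2 = μ + 2 * i := by
        have : (μ + 1) * (μ ^ 2 - (μ + 2 * i)) = 0 := by linear_combination h
        rcases mul_eq_zero.1 this with h | h <;> linarith
      have h3 : μ ≤ i := by
        by_contra! hn
        nlinarith
      nlinarith
    · have hc : 0 ≤ 10 / 3 * (i * m) - 4 * m - 1 := by nlinarith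
      -- `(μ - 3)² ≥ 0` bounds the linear term `4 i m μ`; `μ = 3` is the root for `i = 3`, `m = 1`.
      have h3 : 0 ≤ i * m * (μ - 3) ^ 2 := by positivity
      have h5 := mul_le_mul_of_nonneg_left h2.le hc
      have h6 : 0 < (10 / 3 * (i * m) - 4 * m - 1) * (i + m + i * m) - 6 * (i * m)
          - (8 * i - 4) * m ^ 2 := by
        obtain ⟨a, rfl⟩ : ∃ a, i = 3 + a := ⟨i - 3, by ring⟩
        obtain ⟨b, rfl⟩ : ∃ b, m = 2 + b := ⟨m - 2, by ring⟩
        have ha : 0 ≤ a := by linarith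
        have hb : 0 ≤ b := by linarith
        ring_nf
        positivity
      linarith
  have e : μ ^ 2 * ((μ ^ 2 - (i - 1 + m + i * m)) ^ 2 - 4 * ((i - 1) * m)) =
      (μ + 2 * i * m) ^ 2 - 4 * ((i - 1) * m) * μ ^ 2 := by rw [← h1]; ring
  rw [e]
  linarith

/-! ### Comparison of the energies -/

theorem proposition4p3 :
    (∀ n : ℕ, 4 ≤ n →
      ∀ u v : TripartiteVertex 1 2 (n - 3), u.1 = 0 → v.1 = 1 →
        graphEnergy ((completeTripartite 1 2 (n - 3)).deleteEdges {s(u, v)})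
          < graphEnergy (completeTripartite 1 2 (n - 3))) ∧
    (∀ n i : ℕ, 3 ≤ i → i + 2 ≤ n →
      ∀ u v : TripartiteVertex 1 i (n - i - 1), u.1 = 0 → v.1 = 1 →
        graphEnergy (completeTripartite 1 i (n - i - 1))
          < graphEnergy ((completeTripartite 1 i (n - i - 1)).deleteEdges {s(u, v)})) := by
  refine ⟨fun n hn u v hu hv => ?_, fun n i hi hn u v hu hv => ?_⟩
  · have hm : 1 ≤ n - 3 := by omega
    generalize n - 3 = m at *
    obtain ⟨μ, hμ, hμ3, hμE⟩ := graphEnergy_completeTripartite (i := 2) two_pos hm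
    obtain ⟨σ, hσ, -, hσ4, hσE⟩ := graphEnergy_completeTripartite_deleteEdges le_rfl hm u v hu hv
    push_cast at hμ3 hσ4
    have hm' : (1 : ℝ) ≤ m := by exact_mod_cast hm
    have hlt : σ < μ := lt_of_resolvent_lt hμ hσ
      (by
        by_contra! hle
        nlinarith [mul_le_mul_of_nonneg_right hle hμ.le])
      hσ4 (resolvent_gt_of_cubic_root_two hm' hμ hμ3)
    rw [hμE, hσE]
    linarith
  · have hm : 1 ≤ n - i - 1 := by omega
    generalize n - i - 1 = m at *
    obtain ⟨μ, hμ, hμ3, hμE⟩ := graphEnergy_completeTripartite (i := i) (by omega) hm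
    obtain ⟨σ, hσ, hEσ, hσ4, hσE⟩ :=
      graphEnergy_completeTripartite_deleteEdges (by omega) hm u v hu hv
    have hm' : (m : ℝ) = 1 ∨ (2 : ℝ) ≤ m := by
      rcases hm.eq_or_lt with h | h
      · exact Or.inl (by exact_mod_cast h.symm)
      · exact Or.inr (by exact_mod_cast h)
    have hlt : μ < σ :=
      lt_of_lt_resolvent hσ hEσ hσ4 (resolvent_lt_of_cubic_root (by exact_mod_cast hi) hm' hμ hμ3)
    rw [hμE, hσE]
    linarith
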